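/- Let $p\geqslant 3$ be a prime. A $\mathbb{Z}_p$-Lie lattice is a Lie algebra over $\mathbb{Z}_p$ whose underlying module is finitely generated and free. A $\mathbb{Z}_p$-Lie lattice $L$ is self-similar of index $p^k$ if there are a subalgebra $M\subseteq L$ of index $p^k$ and a homomorphism of Lie algebras $\varphi:M\to L$ such that the only ideal $I$ of $L$ with $I\subseteq M$ and $\varphi(I)\subseteq I$ is $I=\{0\}$. It is hereditarily self-similar of index $p^k$ if every finite-index subalgebra of $L$ (including $L$ itself) is self-similar of index $p^k$. Let $L_0$ be the abelian $\mathbb{Z}_p$-Lie lattice of dimension $3$, and for $s\in\mathbb{N}=\{0,1,2,\dots\}$ let $L_1(s)$ be the $\mathbb{Z}_p$-Lie lattice with basis $(x_0,x_1,x_2)$ and brackets $[x_1,x_2]=0$, $[x_0,x_1]=p^s x_1$, $[x_0,x_2]=p^s x_2$. Let $L$ be a $3$-dimensional $\mathbb{Z}_p$-Lie lattice (solvable or not). Then $L$ is hereditarily self-similar of index $p$ if and only if $L\simeq L_0$ or $L\simeq L_1(s)$ for some $s\in\mathbb{N}$. -/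

import Mathlib

/-- Let `M` be a subalgebra of `L` and `φ : M → L` a homomorphism of Lie algebras. An ideal `I` of
`L` is `φ`-invariant if `I ⊆ M` and `φ(I) ⊆ I`. -/
def IsInvariantIdeal {R L : Type*} [CommRing R] [LieRing L] [LieAlgebra R L]
    {M : LieSubalgebra R L} (φ : M →ₗ⁅R⁆ L) (I : LieIdeal R L) : Prop :=
  ∀ x ∈ I, ∃ h : x ∈ M, φ ⟨x, h⟩ ∈ I

/-- `φ : M → L` is simple if the only `φ`-invariant ideal of `L` is zero. -/
def IsSimpleVirtualEndomorphism {R L : Type*} [CommRing R] [LieRing L] [LieAlgebra R L]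
    {M : LieSubalgebra R L} (φ : M →ₗ⁅R⁆ L) : Prop :=
  ∀ I : LieIdeal R L, IsInvariantIdeal φ I → I = ⊥

/-- The `ℤ_p`-Lie algebra `L` is self-similar of index `p ^ k`: there are a subalgebra `M` of `L`
of index `p ^ k` (as an additive subgroup) and a simple homomorphism of Lie algebras `M → L`. -/
def IsSelfSimilarOfIndex (p : ℕ) [Fact p.Prime] (k : ℕ) (L : Type*) [LieRing L]
    [LieAlgebra ℤ_[p] L] : Prop :=
  ∃ (M : LieSubalgebra ℤ_[p] L) (φ : M →ₗ⁅ℤ_[p]⁆ L),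
    M.toSubmodule.toAddSubgroup.index = p ^ k ∧ IsSimpleVirtualEndomorphism φ

/-- `L` is hereditarily self-similar of index `p ^ k`: every finite-index subalgebra of `L`
(including `L` itself) is self-similar of index `p ^ k`. -/
def IsHereditarilySelfSimilarOfIndex (p : ℕ) [Fact p.Prime] (k : ℕ) (L : Type*) [LieRing L]
    [LieAlgebra ℤ_[p] L] : Prop :=
  ∀ N : LieSubalgebra ℤ_[p] L, N.toSubmodule.toAddSubgroup.FiniteIndex →
    IsSelfSimilarOfIndex p k N

/-- The underlying module `ℤ_p³` of the Lie lattice with basis `x₀, x₁, x₂` and relations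
`[x₁, x₂] = 0`, `[x₀, x₁] = a x₁`, `[x₀, x₂] = a x₂`. -/
def ScalarLattice (p : ℕ) [Fact p.Prime] (_a : ℤ_[p]) : Type := Fin 3 → ℤ_[p]

namespace ScalarLattice

variable (p : ℕ) [Fact p.Prime] (a : ℤ_[p])

noncomputable instance : AddCommGroup (ScalarLattice p a) := inferInstanceAs (AddCommGroup (Fin 3 → ℤ_[p]))

noncomputable instance : Module ℤ_[p] (ScalarLattice p a) := inferInstanceAs (Module ℤ_[p] (Fin 3 → ℤ_[p]))

/-- The bilinear extension of the relations: `[u, v] = a (0, u₀v₁ - u₁v₀, u₀v₂ - u₂v₀)`. -/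
noncomputable instance : Bracket (ScalarLattice p a) (ScalarLattice p a) where
  bracket u v := fun i : Fin 3 => a * (u 0 * v i - u i * v 0)

theorem bracket_apply (u v : ScalarLattice p a) (i : Fin 3) :
    ⁅u, v⁆ i = a * (u 0 * v i - u i * v 0) := rfl

theorem add_apply (u v : ScalarLattice p a) (i : Fin 3) : (u + v) i = u i + v i := rfl

theorem zero_apply (i : Fin 3) : (0 : ScalarLattice p a) i = 0 := rfl

theorem smul_apply (c : ℤ_[p]) (u : ScalarLattice p a) (i : Fin 3) : (c • u) i = c * u i := rfl

noncomputable instance : LieRing (ScalarLattice p a) where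
  add_lie u v w := by
    refine funext fun i => ?_
    simp only [bracket_apply, add_apply]
    ring
  lie_add u v w := by
    refine funext fun i => ?_
    simp only [bracket_apply, add_apply]
    ring
  lie_self u := by
    refine funext fun i => ?_
    simp only [bracket_apply, zero_apply]
    ring
  leibniz_lie u v w := by
    refine funext fun i => ?_
    simp only [bracket_apply, add_apply]
    ring

noncomputable instance : LieAlgebra ℤ_[p] (ScalarLattice p a) where
  lie_smul c u v := by
    refine funext fun i => ?_
    simp only [bracket_apply, smul_apply]
    ring

end ScalarLattice

/-- The abelian 3-dimensional Lie lattice `L₀`. -/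
abbrev LieLatticeL0 (p : ℕ) [Fact p.Prime] : Type := ScalarLattice p 0

/-- The Lie lattice `L₁(s)` with basis `x₀, x₁, x₂` and relations
`[x₁, x₂] = 0`, `[x₀, x₁] = p ^ s x₁`, `[x₀, x₂] = p ^ s x₂`. -/
abbrev LieLatticeL1 (p : ℕ) [Fact p.Prime] (s : ℕ) : Type := ScalarLattice p ((p : ℤ_[p]) ^ s)

/-!
In coordinates, a three-dimensional bracket is `[x, y] = S (x × y) + l(x) y - l(y) x` with a
symmetric matrix `S` and a linear functional `l` (`HasStructure`, `exists_hasStructure`), and the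
lattices `L₀`, `L₁(s)` are exactly those with `S = 0` (`exists_lieEquiv_scalarLattice`).

If `S = 0`, then every finite-index subalgebra is of the same kind, and explicit coordinate maps
show that it is self-similar of index `p` (`ScalarLattice.isSelfSimilarOfIndex`).

If `S ≠ 0`, some finite-index subalgebra `N` is not self-similar of index `p`. The form `S` is
diagonalised over `ℚ_p`, and rescaling produces an `N` with `S = diag (d 0, d 1, d 2)` whose entries
are increasingly divisible by `p` (`PadicInt.exists_diagonalization`,
`HasStructure.exists_subalgebra`). Let `φ : M → N` be a simple homomorphism with `M` of index `p`,
and put `G x = φ (p x)`. Then `[G x, G y] = p G [x, y]`, the matrix `G` has rank at most one modulo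
`p`, and `G` is injective. The bracket relation forces `D (cof G) = p G D` for `D = diag d`
(`similitude_of_lie_multiplier`). As all `2 × 2` minors of `G` are divisible by `p`, this makes the
entries of `G` below the diagonal highly divisible by `p`, and then the relevant diagonal entries
divisible by `p`. Consequently some nonzero ideal `J` of `N` satisfies `G J ⊆ p J`
(`exists_contracted_flag`), so `p J` is a nonzero `φ`-invariant ideal, a contradiction.
-/

open Matrix

/-! ### Symmetric and antisymmetric part of a three-dimensional bracket -/

/-- In the basis `b`, a three-dimensional bracket has the form
`[x, y] = S (x × y) + l(x) y - l(y) x`, where `×` is the cross product of coordinate vectors. -/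
def HasStructure {R L : Type*} [CommRing R] [LieRing L] [LieAlgebra R L]
    (b : Module.Basis (Fin 3) R L) (S : Matrix (Fin 3) (Fin 3) R) (l : Fin 3 → R) : Prop :=
  ∀ x y : L, b.equivFun ⁅x, y⁆ = S *ᵥ (b.equivFun x ⨯₃ b.equivFun y) +
    (l ⬝ᵥ b.equivFun x) • b.equivFun y - (l ⬝ᵥ b.equivFun y) • b.equivFun x

section Structure

variable {R L : Type*} [CommRing R] [LieRing L] [LieAlgebra R L]

theorem lie_eq_cross (b : Module.Basis (Fin 3) R L) (x y : L) :
    ⁅x, y⁆ = (b.equivFun x ⨯₃ b.equivFun y) 0 • ⁅b 1, b 2⁆ +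
      (b.equivFun x ⨯₃ b.equivFun y) 1 • ⁅b 2, b 0⁆ +
      (b.equivFun x ⨯₃ b.equivFun y) 2 • ⁅b 0, b 1⁆ := by
  have h1 : ⁅b 2, b 1⁆ = -⁅b 1, b 2⁆ := (lie_skew _ _).symm
  have h2 : ⁅b 0, b 2⁆ = -⁅b 2, b 0⁆ := (lie_skew _ _).symm
  have h3 : ⁅b 1, b 0⁆ = -⁅b 0, b 1⁆ := (lie_skew _ _).symm
  conv_lhs => rw [← b.sum_equivFun x, ← b.sum_equivFun y]
  simp only [Fin.sum_univ_three, cross_apply, add_lie, lie_add, smul_lie, lie_smul, lie_self, h1,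
    h2, h3, Matrix.cons_val]
  module

/-- Every three-dimensional bracket splits into a symmetric matrix and a linear functional: these
are the symmetric and the antisymmetric part of the matrix of structure constants. -/
theorem exists_hasStructure (b : Module.Basis (Fin 3) R L) (h2 : IsUnit (2 : R)) :
    ∃ S l, S.IsSymm ∧ HasStructure b S l := by
  obtain ⟨c, hc⟩ := h2.exists_left_inv
  set A : Matrix (Fin 3) (Fin 3) R :=
    .of fun i j => b.equivFun (![⁅b 1, b 2⁆, ⁅b 2, b 0⁆, ⁅b 0, b 1⁆] j) i with hA
  -- Here `c = 1 / 2`.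
  refine ⟨c • (A + Aᵀ), -c • ![A 2 1 - A 1 2, A 0 2 - A 2 0, A 1 0 - A 0 1], ?_, fun x y => ?_⟩
  · ext i j
    simp [add_comm, mul_add]
  · have e0 : ∀ i, b.equivFun ⁅b 1, b 2⁆ i = A i 0 := fun i => rfl
    have e1 : ∀ i, b.equivFun ⁅b 2, b 0⁆ i = A i 1 := fun i => rfl
    have e2 : ∀ i, b.equivFun ⁅b 0, b 1⁆ i = A i 2 := fun i => rfl
    rw [lie_eq_cross b x y]
    ext i
    simp only [map_add, map_smul, Pi.add_apply, Pi.smul_apply, e0, e1, e2]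
    generalize b.equivFun x = u
    generalize b.equivFun y = v
    clear_value A
    have hw := cross_apply u v
    generalize hw' : u ⨯₃ v = w at hw ⊢
    have hi : w 0 * A i 0 + w 1 * A i 1 + w 2 * A i 2 =
        c * 2 * (w 0 * A i 0 + w 1 * A i 1 + w 2 * A i 2) := by rw [hc, one_mul]
    rw [smul_eq_mul, smul_eq_mul, smul_eq_mul, hi, hw]
    fin_cases i <;>
    · simp [mulVec, dotProduct, Fin.sum_univ_three]
      ring

theorem mulVec_cross_mulVec (P : Matrix (Fin 3) (Fin 3) R) (u v : Fin 3 → R) :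
    (P *ᵥ u) ⨯₃ (P *ᵥ v) = P.adjugateᵀ *ᵥ (u ⨯₃ v) := by
  ext i
  fin_cases i <;>
  · simp [adjugate_fin_three, mulVec, dotProduct, Fin.sum_univ_three, cross_apply]
    ring

/-- The Jacobi identity, for a diagonal matrix of structure constants. -/
theorem HasStructure.diagonal_mul_eq_zero {b : Module.Basis (Fin 3) R L} {d l : Fin 3 → R}
    (h : HasStructure b (diagonal d) l) (h2 : IsUnit (2 : R)) (i : Fin 3) : d i * l i = 0 := by
  have key := congrArg (fun z => b.equivFun z i) (lie_jacobi (b 0) (b 1) (b 2))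
  have e : ∀ j, b.equivFun (b j) = Pi.single j 1 := fun j => by
    ext k; simp [Pi.single_apply, eq_comm]
  simp only [map_add, h _ _, e] at key
  refine h2.mul_left_cancel ?_
  fin_cases i <;>
  · simp [mulVec_diagonal, dotProduct, Fin.sum_univ_three, cross_apply] at key ⊢
    linear_combination -key

/-- A change of basis that is invertible over the field of fractions: if `S (cof P) = P D`, then the
columns of `P` span a subalgebra, and `D` is the symmetric part of its bracket. -/
theorem HasStructure.exists_subalgebra [IsDomain R] {b : Module.Basis (Fin 3) R L}
    {S : Matrix (Fin 3) (Fin 3) R} {l : Fin 3 → R} (h : HasStructure b S l)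
    {P D : Matrix (Fin 3) (Fin 3) R} (hP : P.det ≠ 0) (hPD : S * P.adjugateᵀ = P * D) :
    ∃ (N : LieSubalgebra R L) (b' : Module.Basis (Fin 3) R N) (l' : Fin 3 → R),
      HasStructure b' D l' ∧ ∀ x : L, P.det • x ∈ N := by
  let f : (Fin 3 → R) →ₗ[R] L := b.equivFun.symm.toLinearMap ∘ₗ P.mulVecLin
  have hf : ∀ u, b.equivFun (f u) = P *ᵥ u := fun u => b.equivFun.apply_symm_apply _
  have hinj : Function.Injective f := b.equivFun.symm.injective.comp
    (mulVec_injective_of_det_mem_nonZeroDivisors (mem_nonZeroDivisors_of_ne_zero hP))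
  have hlie : ∀ u v, ⁅f u, f v⁆ =
      f (D *ᵥ (u ⨯₃ v) + ((l ᵥ* P) ⬝ᵥ u) • v - ((l ᵥ* P) ⬝ᵥ v) • u) := fun u v => by
    apply b.equivFun.injective
    rw [h, hf, hf, hf, mulVec_cross_mulVec, mulVec_sub, mulVec_add, mulVec_smul, mulVec_smul,
      mulVec_mulVec, mulVec_mulVec, hPD, dotProduct_mulVec, dotProduct_mulVec]
  let N : LieSubalgebra R L :=
    { LinearMap.range f with
      lie_mem' := by
        rintro _ _ ⟨u, rfl⟩ ⟨v, rfl⟩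
        exact ⟨_, (hlie u v).symm⟩ }
  let e : (Fin 3 → R) ≃ₗ[R] N := LinearEquiv.ofInjective f hinj
  have he : ∀ u, (e u : L) = f u := fun u => rfl
  refine ⟨N, .ofEquivFun e.symm, l ᵥ* P, fun x y => ?_, fun x => ?_⟩
  · rw [Module.Basis.equivFun_ofEquivFun, LinearEquiv.symm_apply_eq]
    obtain ⟨u, rfl⟩ := e.surjective x
    obtain ⟨v, rfl⟩ := e.surjective y
    rw [e.symm_apply_apply, e.symm_apply_apply]
    exact Subtype.ext (hlie u v)
  · refine ⟨P.adjugate *ᵥ b.equivFun x, b.equivFun.injective ?_⟩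
    rw [hf, mulVec_mulVec, mul_adjugate, smul_mulVec, one_mulVec, map_smul]

/-- If `r` diagonalises `S` as a bilinear form on the dual lattice, then its adjugate is a change of
basis that brings the bracket into diagonal form. -/
theorem mul_adjugate_adjugate_transpose_eq {S r : Matrix (Fin 3) (Fin 3) R} {d : Fin 3 → R}
    (hr : r * S * rᵀ = diagonal d) : S * r.adjugate.adjugateᵀ = r.adjugate * diagonal d := by
  rw [← hr, mul_assoc, ← mul_assoc r.adjugate, adjugate_mul, adjugate_adjugate _ (by simp)]
  simp

end Structure

/-! ### Endomorphisms that multiply the bracket by a constant -/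

section Multiplier

variable {R : Type*} [CommRing R] [IsDomain R]

/-- Let `G` be an injective endomorphism of a diagonal bracket with `[G x, G y] = c G [x, y]`.
Then `G` multiplies the functional `l` by `c`, and it is a similitude of the diagonal form.
Multiplying the homomorphism relation by `adj G` gives an equality between a symmetric matrix and
the antisymmetric matrix that belongs to `l ∘ G - c l`, so both vanish. -/
theorem similitude_of_lie_multiplier (h2 : (2 : R) ≠ 0) {G : Matrix (Fin 3) (Fin 3) R}
    (hG : G.det ≠ 0) {d l : Fin 3 → R} {c : R}
    (h : ∀ u v : Fin 3 → R, diagonal d *ᵥ ((G *ᵥ u) ⨯₃ (G *ᵥ v)) +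
      (l ⬝ᵥ (G *ᵥ u)) • (G *ᵥ v) - (l ⬝ᵥ (G *ᵥ v)) • (G *ᵥ u) =
        c • (G *ᵥ (diagonal d *ᵥ (u ⨯₃ v) + (l ⬝ᵥ u) • v - (l ⬝ᵥ v) • u))) :
    diagonal d * G.adjugateᵀ = c • (G * diagonal d) := by
  set m : Fin 3 → R := l ᵥ* G - c • l with hm
  set Y : Matrix (Fin 3) (Fin 3) R := diagonal d * G.adjugateᵀ - c • (G * diagonal d) with hY
  have hYw : ∀ u v, Y *ᵥ (u ⨯₃ v) = (m ⬝ᵥ v) • (G *ᵥ u) - (m ⬝ᵥ u) • (G *ᵥ v) := fun u v => by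
    have := h u v
    rw [mulVec_cross_mulVec, mulVec_sub, mulVec_add, mulVec_smul, mulVec_smul, mulVec_mulVec,
      mulVec_mulVec, dotProduct_mulVec, dotProduct_mulVec] at this
    rw [hY, hm, sub_mulVec, smul_mulVec, sub_dotProduct, sub_dotProduct, smul_dotProduct,
      smul_dotProduct, smul_eq_mul, smul_eq_mul]
    rw [← sub_eq_zero] at this ⊢
    rw [← this]
    module
  set X := G.adjugate * Y with hX
  have hXw : ∀ u v, X *ᵥ (u ⨯₃ v) = G.det • ((m ⬝ᵥ v) • u - (m ⬝ᵥ u) • v) := fun u v => by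
    rw [hX, ← mulVec_mulVec, hYw, mulVec_sub, mulVec_smul, mulVec_smul, mulVec_mulVec,
      mulVec_mulVec, adjugate_mul, smul_mulVec, smul_mulVec, one_mulVec, one_mulVec]
    module
  have hXs : Xᵀ = X := by
    have : X = G.adjugate * diagonal d * G.adjugateᵀ - (c * G.det) • diagonal d := by
      rw [hX, hY, mul_sub, mul_assoc, mul_smul_comm, ← mul_assoc G.adjugate G, adjugate_mul,
        smul_mul_assoc, one_mul, smul_smul]
    rw [this]
    simp [mul_assoc]
  have hs : ∀ i j, X i j = X j i := fun i j => congrFun (congrFun hXs j) i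
  -- The columns of `X` are its values on the cross products of the coordinate vectors.
  have c0 := hXw (Pi.single 1 1) (Pi.single 2 1)
  have c1 := hXw (Pi.single 2 1) (Pi.single 0 1)
  have c2 := hXw (Pi.single 0 1) (Pi.single 1 1)
  have hX0 : X = 0 := by
    have e : ∀ k : Fin 3, ∀ a b : Fin 3 → R, a = b → a k = b k := fun k a b h => congrFun h k
    have z : ∀ a : R, a = -a → a = 0 := fun a ha => by
      have : 2 * a = 0 := by linear_combination ha
      exact (mul_eq_zero.mp this).resolve_left h2
    have c00 := e 0 _ _ c0
    have c01 := e 1 _ _ c0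
    have c02 := e 2 _ _ c0
    have c10 := e 0 _ _ c1
    have c11 := e 1 _ _ c1
    have c12 := e 2 _ _ c1
    have c20 := e 0 _ _ c2
    have c21 := e 1 _ _ c2
    have c22 := e 2 _ _ c2
    simp [mulVec, dotProduct, cross_apply, Fin.sum_univ_three, -mul_eq_mul_left_iff]
      at c00 c01 c02 c10 c11 c12 c20 c21 c22
    have z01 := z (X 0 1) (by linear_combination c10 + c01 + hs 0 1)
    have z02 := z (X 0 2) (by linear_combination c20 + c02 + hs 0 2)
    have z12 := z (X 1 2) (by linear_combination c21 + c12 + hs 1 2)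
    ext i j
    fin_cases i <;> fin_cases j <;> simp only [Fin.zero_eta, Fin.mk_one, Fin.reduceFinMk,
      Matrix.zero_apply, c00, c11, c22, z01, z02, z12, hs 1 0, hs 2 0, hs 2 1]
  have hY0 : Y = 0 := by
    have : G * X = G.det • Y := by rw [hX, ← mul_assoc, mul_adjugate, smul_mul_assoc, one_mul]
    rw [hX0, mul_zero] at this
    exact (smul_eq_zero.mp this.symm).resolve_left hG
  exact sub_eq_zero.mp hY0

end Multiplier

/-! ### Contracted ideals -/

section Flag

variable {R : Type*} [CommRing R] [IsDomain R]

/-- Coordinates in which a similitude `G` of a diagonal form with rapidly decreasing entries maps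
the ideal given by `α ∣ u 1` and `β ∣ u 2` into its multiple by `π`. The rows of `G` below the
diagonal are highly divisible by the similitude relation; the rank condition modulo `π` on `G` makes
the relevant diagonal entries divisible by `π`. The ideal has the rank of the form: `(α, β)` is
`(0, 0)`, `(π, 0)` or `(π, π ^ 2)`, and its first condition on `u`, `v` says that it is an ideal. -/
theorem exists_contracted_flag {π : R} (hπ : Prime π) {G : Matrix (Fin 3) (Fin 3) R}
    {d l : Fin 3 → R} (hdl : ∀ i, d i * l i = 0) (hd0 : d 0 ≠ 0)
    (hd1 : π ^ 3 * d 0 ∣ d 1) (hd2 : π ^ 3 * d 1 ∣ d 2)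
    (hmin : ∀ i j k m, π ∣ G i j * G k m - G i m * G k j)
    (hsim : diagonal d * G.adjugateᵀ = π • (G * diagonal d)) :
    ∃ α β : R, (∀ u v : Fin 3 → R, α ∣ u 1 → β ∣ u 2 →
        α ∣ d 1 * (v 2 * u 0 - v 0 * u 2) + (l ⬝ᵥ v) * u 1 - (l ⬝ᵥ u) * v 1 ∧
        β ∣ d 2 * (v 0 * u 1 - v 1 * u 0) + (l ⬝ᵥ v) * u 2 - (l ⬝ᵥ u) * v 2) ∧
      ∀ u : Fin 3 → R, α ∣ u 1 → β ∣ u 2 →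
        π ∣ (G *ᵥ u) 0 ∧ π * α ∣ (G *ᵥ u) 1 ∧ π * β ∣ (G *ᵥ u) 2 := by
  have hπ0 : π ≠ 0 := hπ.ne_zero
  obtain ⟨ρ, hρ⟩ := hd1
  obtain ⟨τ, hτ⟩ := hd2
  -- All cofactors are divisible by `π`, so the similitude relation can be divided by `π`.
  have hq : ∀ i j, ∃ q, G.adjugate j i = π * q ∧ d i * q = G i j * d j := fun i j => by
    have hdvd : π ∣ G.adjugate j i := by
      rw [adjugate_fin_succ_eq_det_submatrix, det_fin_two]
      exact (hmin _ _ _ _).mul_left _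
    obtain ⟨q, hq⟩ := hdvd
    refine ⟨q, hq, mul_left_cancel₀ hπ0 ?_⟩
    have := congrFun (congrFun hsim i) j
    rw [diagonal_mul, transpose_apply, hq, Matrix.smul_apply, mul_diagonal, smul_eq_mul] at this
    linear_combination this
  have hl0 : l 0 = 0 := (mul_eq_zero.mp (hdl 0)).resolve_left hd0
  have hdot : ∀ u, l ⬝ᵥ u = l 1 * u 1 + l 2 * u 2 := fun u => by
    rw [dotProduct, Fin.sum_univ_three, hl0]; ring
  have hG : ∀ u i, (G *ᵥ u) i = G i 0 * u 0 + G i 1 * u 1 + G i 2 * u 2 := fun u i => by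
    rw [mulVec, dotProduct, Fin.sum_univ_three]
  obtain ⟨q00, e00, f00⟩ := hq 0 0
  obtain ⟨q10, e10, f10⟩ := hq 1 0
  obtain ⟨q20, e20, f20⟩ := hq 2 0
  obtain ⟨q21, e21, f21⟩ := hq 2 1
  obtain ⟨q11, e11, f11⟩ := hq 1 1
  obtain ⟨q22, e22, f22⟩ := hq 2 2
  simp only [adjugate_fin_three, of_apply, cons_val] at e00 e10 e20 e21 e11 e22
  have g00 : π * G 0 0 = G 1 1 * G 2 2 - G 1 2 * G 2 1 := by
    have : G 0 0 = q00 := mul_left_cancel₀ hd0 (by linear_combination -f00)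
    rw [this]; linear_combination -e00
  have g10 : G 1 0 = π ^ 3 * (ρ * q10) := mul_left_cancel₀ hd0 (by
    linear_combination -f10 + q10 * hρ)
  have g20 : G 2 0 = π ^ 6 * (ρ * τ * q20) := mul_left_cancel₀ hd0 (by
    linear_combination -f20 + q20 * hτ + q20 * π ^ 3 * τ * hρ)
  have key : ∀ a b c t : R, π ∣ a → π ∣ c → π * b = a * c - π ^ 2 * t → π ∣ b := by
    rintro _ b _ t ⟨a, rfl⟩ ⟨c, rfl⟩ h
    exact ⟨a * c - t, mul_left_cancel₀ hπ0 (by linear_combination h)⟩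
  have m01 : π ∣ G 0 0 * G 1 1 := by
    obtain ⟨k, hk⟩ := hmin 0 0 1 1
    exact ⟨k + G 0 1 * π ^ 2 * (ρ * q10), by linear_combination hk + G 0 1 * g10⟩
  have m02 : π ∣ G 0 0 * G 2 2 := by
    obtain ⟨k, hk⟩ := hmin 0 0 2 2
    exact ⟨k + G 0 2 * π ^ 5 * (ρ * τ * q20), by linear_combination hk + G 0 2 * g20⟩
  by_cases hd1 : d 1 = 0
  · -- Only `d 0` is nonzero: the line spanned by `e₀` is contracted.
    have hd2 : d 2 = 0 := by rw [hτ, hd1]; ring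
    have z10 : G 1 0 = 0 := mul_left_cancel₀ hd0 (by linear_combination -f10 + q10 * hd1)
    have z20 : G 2 0 = 0 := mul_left_cancel₀ hd0 (by linear_combination -f20 + q20 * hd2)
    have h00 : π ∣ G 0 0 := by
      by_contra hn
      have p11 := (hπ.dvd_or_dvd m01).resolve_left hn
      have p22 := (hπ.dvd_or_dvd m02).resolve_left hn
      have p12 : π ∣ G 1 2 := by
        have := hmin 0 0 1 2
        rw [z10, mul_zero, sub_zero] at this
        exact (hπ.dvd_or_dvd this).resolve_left hn
      have p21 : π ∣ G 2 1 := by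
        have := hmin 0 0 2 1
        rw [z20, mul_zero, sub_zero] at this
        exact (hπ.dvd_or_dvd this).resolve_left hn
      obtain ⟨a, ha⟩ := p11
      obtain ⟨b, hb⟩ := p22
      obtain ⟨c, hc⟩ := p12
      obtain ⟨e, he⟩ := p21
      rw [ha, hb, hc, he] at g00
      exact hn ⟨a * b - c * e, mul_left_cancel₀ hπ0 (by linear_combination g00)⟩
    refine ⟨0, 0, fun u v h1 h2 => ?_, fun u h1 h2 => ?_⟩
    · rw [zero_dvd_iff] at h1 h2
      rw [hdot u, hd1, hd2, h1, h2]
      simp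
    · rw [zero_dvd_iff] at h1 h2
      simp only [hG, h1, h2, z10, z20, mul_zero, add_zero, zero_mul, dvd_refl, and_true]
      exact h00.mul_right _
  have hl1 : l 1 = 0 := (mul_eq_zero.mp (hdl 1)).resolve_left hd1
  have g21 : G 2 1 = π ^ 3 * (τ * q21) := mul_left_cancel₀ hd1 (by
    linear_combination -f21 + q21 * hτ)
  have g11 : π * G 1 1 = G 0 0 * G 2 2 - G 0 2 * G 2 0 := by
    have : G 1 1 = q11 := mul_left_cancel₀ hd1 (by linear_combination -f11)
    rw [this]; linear_combination -e11
  have m12 : π ∣ G 1 1 * G 2 2 := by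
    obtain ⟨k, hk⟩ := hmin 1 1 2 2
    exact ⟨k + G 1 2 * π ^ 2 * (τ * q21), by linear_combination hk + G 1 2 * g21⟩
  have hπ1 : π * (π : R) ∣ d 1 := ⟨π * d 0 * ρ, by linear_combination hρ⟩
  by_cases hd2 : d 2 = 0
  · -- Only `d 2` vanishes: the ideal spanned by `e₀` and `π e₁` is contracted.
    have z20 : G 2 0 = 0 := mul_left_cancel₀ hd0 (by linear_combination -f20 + q20 * hd2)
    have z21 : G 2 1 = 0 := mul_left_cancel₀ hd1 (by linear_combination -f21 + q21 * hd2)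
    rw [z21, mul_zero, sub_zero] at g00
    rw [z20, mul_zero, sub_zero] at g11
    have h01 : π ∣ G 0 0 ∧ π ∣ G 1 1 := by
      by_cases h22 : π ∣ G 2 2
      · obtain h | h := hπ.dvd_or_dvd m01
        · exact ⟨h, key _ _ _ 0 h h22 (by linear_combination g11)⟩
        · exact ⟨key _ _ _ 0 h h22 (by linear_combination g00), h⟩
      · exact ⟨(hπ.dvd_or_dvd m02).resolve_right h22, (hπ.dvd_or_dvd m12).resolve_right h22⟩
    obtain ⟨⟨a, ha⟩, ⟨b, hb⟩⟩ := h01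
    refine ⟨π, 0, fun u v h1 h2 => ?_, fun u h1 h2 => ?_⟩
    · rw [zero_dvd_iff] at h2
      rw [hdot u, hd2, h2, hl1]
      simp only [mul_zero, zero_mul, add_zero, sub_zero, dvd_refl, and_true]
      exact ((dvd_of_mul_right_dvd hπ1).mul_right _).add (h1.mul_left _)
    · obtain ⟨w, hw⟩ := h1
      rw [zero_dvd_iff] at h2
      simp only [hG, h2, hw, z20, z21, ha, hb, g10]
      refine ⟨⟨a * u 0 + G 0 1 * w, by ring⟩, ⟨π * (ρ * q10) * u 0 + b * w, by ring⟩, by simp⟩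
  · -- No entry vanishes: `l` is zero, and the ideal spanned by `e₀`, `π e₁`, `π ^ 2 e₂` is
    -- contracted.
    have hl2 : l 2 = 0 := (mul_eq_zero.mp (hdl 2)).resolve_left hd2
    have g22 : π * G 2 2 = G 0 0 * G 1 1 - G 0 1 * G 1 0 := by
      have : G 2 2 = q22 := mul_left_cancel₀ hd2 (by linear_combination -f22)
      rw [this]; linear_combination -e22
    have h012 : (π ∣ G 0 0 ∧ π ∣ G 1 1) ∧ π ∣ G 2 2 := by
      have r0 : π ∣ G 1 1 → π ∣ G 2 2 → π ∣ G 0 0 := fun h h' =>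
        key _ _ _ (G 1 2 * π * (τ * q21)) h h' (by linear_combination g00 - G 1 2 * g21)
      have r1 : π ∣ G 0 0 → π ∣ G 2 2 → π ∣ G 1 1 := fun h h' =>
        key _ _ _ (G 0 2 * π ^ 4 * (ρ * τ * q20)) h h' (by linear_combination g11 - G 0 2 * g20)
      have r2 : π ∣ G 0 0 → π ∣ G 1 1 → π ∣ G 2 2 := fun h h' =>
        key _ _ _ (G 0 1 * π * (ρ * q10)) h h' (by linear_combination g22 - G 0 1 * g10)
      -- The relations are symmetric: two of the three diagonal entries are divisible by `π`.
      have := hπ.dvd_or_dvd m01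
      have := hπ.dvd_or_dvd m02
      have := hπ.dvd_or_dvd m12
      tauto
    obtain ⟨⟨⟨a, ha⟩, ⟨b, hb⟩⟩, ⟨c, hc⟩⟩ := h012
    refine ⟨π, π ^ 2, fun u v h1 h2 => ?_, fun u h1 h2 => ?_⟩
    · simp only [hdot, hl1, hl2, zero_mul, add_zero, sub_zero]
      refine ⟨(dvd_of_mul_right_dvd hπ1).mul_right _, ?_⟩
      rw [sq]
      exact (hπ1.trans ⟨π ^ 3 * τ, by linear_combination hτ⟩).mul_right _
    · obtain ⟨w, hw⟩ := h1
      obtain ⟨x, hx⟩ := h2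
      simp only [hG, hw, hx, ha, hb, hc, g10, g20, g21]
      refine ⟨⟨a * u 0 + G 0 1 * w + G 0 2 * π * x, by ring⟩,
        ⟨π * (ρ * q10) * u 0 + b * w + G 1 2 * x, by ring⟩,
        ⟨π ^ 3 * (ρ * τ * q20) * u 0 + π * (τ * q21) * w + c * x, by ring⟩⟩

end Flag

/-! ### Lattices that are not self-similar of index `p` -/

section Obstruction

variable {p : ℕ} [Fact p.Prime] {N : Type*} [LieRing N] [LieAlgebra ℤ_[p] N]

/-- A simple virtual endomorphism `φ` of index `p` yields the everywhere defined linear map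
`G x = φ (p x)`. It multiplies brackets by `p`, has rank at most one modulo `p` because it maps the
domain of `φ` into `p N`, and no nonzero ideal `J` satisfies `G J ⊆ p J`, since `p J` would be
`φ`-invariant. -/
theorem IsSelfSimilarOfIndex.exists_linearMap [Module.IsTorsionFree ℤ_[p] N]
    (h : IsSelfSimilarOfIndex p 1 N) :
    ∃ G : N →ₗ[ℤ_[p]] N, (∀ x y, ⁅G x, G y⁆ = (p : ℤ_[p]) • G ⁅x, y⁆) ∧
      (∀ x y, (∃ z, G x = (p : ℤ_[p]) • z) ∨
        ∃ (c : ℤ_[p]) (z : N), G y = c • G x + (p : ℤ_[p]) • z) ∧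
      ∀ J : LieIdeal ℤ_[p] N, (∀ x ∈ J, ∃ y ∈ J, G x = (p : ℤ_[p]) • y) → J = ⊥ := by
  obtain ⟨M, φ, hM, hφ⟩ := h
  rw [pow_one] at hM
  have hp0 : (p : ℤ_[p]) ≠ 0 := Nat.cast_ne_zero.mpr (Fact.out : p.Prime).ne_zero
  have hpM : ∀ x : N, (p : ℤ_[p]) • x ∈ M := fun x => by
    have := AddSubgroup.nsmul_index_mem M.toSubmodule.toAddSubgroup x
    rw [hM] at this
    rw [Nat.cast_smul_eq_nsmul]
    exact this
  have hcyc : ∀ x y : N, x ∉ M → ∃ n : ℤ, y - n • x ∈ M := fun x y hx => by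
    have hcard : Nat.card (N ⧸ M.toSubmodule.toAddSubgroup) = p := hM
    have hx' : (QuotientAddGroup.mk x : N ⧸ M.toSubmodule.toAddSubgroup) ≠ 0 := by
      rwa [Ne, QuotientAddGroup.eq_zero_iff]
    obtain ⟨n, hn⟩ := AddSubgroup.mem_zmultiples_iff.mp
      (mem_zmultiples_of_prime_card hcard hx' (g' := QuotientAddGroup.mk y))
    refine ⟨n, ?_⟩
    have : (QuotientAddGroup.mk (y - n • x) : N ⧸ M.toSubmodule.toAddSubgroup) = 0 := by
      rw [QuotientAddGroup.mk_sub, QuotientAddGroup.mk_zsmul, hn, sub_self]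
    exact (QuotientAddGroup.eq_zero_iff _).mp this
  let G : N →ₗ[ℤ_[p]] N := (φ : M →ₗ[ℤ_[p]] N) ∘ₗ
    (LinearMap.lsmul ℤ_[p] N p).codRestrict M.toSubmodule hpM
  have hG : ∀ x, G x = φ ⟨(p : ℤ_[p]) • x, hpM x⟩ := fun x => rfl
  have hGM : ∀ x (hx : x ∈ M), G x = (p : ℤ_[p]) • φ ⟨x, hx⟩ := fun x hx => by
    rw [hG, ← map_smul]; rfl
  refine ⟨G, fun x y => ?_, fun x y => ?_, fun J hJ => ?_⟩
  · rw [hG, hG, hG, ← LieHom.map_lie, ← map_smul]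
    congr 1
    apply Subtype.ext
    simp [smul_lie, lie_smul]
  · by_cases hx : x ∈ M
    · exact .inl ⟨_, hGM x hx⟩
    · obtain ⟨n, hn⟩ := hcyc x y hx
      refine .inr ⟨n, φ ⟨_, hn⟩, ?_⟩
      rw [← hGM, map_sub, map_zsmul, Int.cast_smul_eq_zsmul]
      abel
  · let I : LieIdeal ℤ_[p] N :=
      { J.toSubmodule.map (LinearMap.lsmul ℤ_[p] N p) with
        lie_mem := by
          rintro y _ ⟨x, hx, rfl⟩
          exact ⟨⁅y, x⁆, J.lie_mem hx, (lie_smul _ _ _).symm⟩ }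
    have hI : I = ⊥ := hφ I fun z hz => by
      obtain ⟨x, hx, rfl⟩ := hz
      obtain ⟨y, hy, hxy⟩ := hJ x hx
      exact ⟨hpM x, y, hy, hxy.symm⟩
    rw [eq_bot_iff]
    intro x hx
    have hz : (p : ℤ_[p]) • x ∈ I := ⟨x, hx, rfl⟩
    rw [hI, LieSubmodule.mem_bot] at hz
    rw [LieSubmodule.mem_bot]
    exact (smul_eq_zero.mp hz).resolve_left hp0

theorem PadicInt.isUnit_two (hp : 3 ≤ p) : IsUnit (2 : ℤ_[p]) := by
  rw [PadicInt.isUnit_iff]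
  have h := (PadicInt.norm_natCast_eq_one_iff (p := p) (n := 2)).mpr ?_
  · exact_mod_cast h
  · exact (Nat.coprime_primes Fact.out Nat.prime_two).mpr (by omega)

/-- A diagonal bracket with rapidly decreasing entries is not self-similar of index `p`: some
nonzero ideal is contracted by the map `G` of every candidate. -/
theorem not_isSelfSimilarOfIndex_of_hasStructure (hp : 3 ≤ p)
    {b : Module.Basis (Fin 3) ℤ_[p] N} {d l : Fin 3 → ℤ_[p]} (hb : HasStructure b (diagonal d) l)
    (hd0 : d 0 ≠ 0) (hd1 : (p : ℤ_[p]) ^ 3 * d 0 ∣ d 1) (hd2 : (p : ℤ_[p]) ^ 3 * d 1 ∣ d 2) :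
    ¬ IsSelfSimilarOfIndex p 1 N := by
  intro h
  have : Module.Free ℤ_[p] N := .of_basis b
  obtain ⟨G, hlie, hrank, hJ⟩ := IsSelfSimilarOfIndex.exists_linearMap h
  have h2 := PadicInt.isUnit_two hp
  set A := LinearMap.toMatrix b b G with hA
  have hAG : ∀ x, b.equivFun (G x) = A *ᵥ b.equivFun x := fun x =>
    (LinearMap.toMatrix_mulVec_repr b b G x).symm
  have hmem : ∀ (J : LieIdeal ℤ_[p] N), (∀ x ∈ J, ∃ y ∈ J, G x = (p : ℤ_[p]) • y) → ∀ x ∈ J,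
      x = 0 := fun J h x hx => by
    rwa [hJ J h, LieSubmodule.mem_bot] at hx
  have hp0 : (p : ℤ_[p]) ≠ 0 := Nat.cast_ne_zero.mpr (Fact.out : p.Prime).ne_zero
  -- The kernel of `G` is an ideal that `G` contracts.
  have hdet : A.det ≠ 0 := by
    intro h0
    obtain ⟨v, hv, hv0⟩ := exists_mulVec_eq_zero_iff.mpr h0
    let J : LieIdeal ℤ_[p] N :=
      { LinearMap.ker G with
        lie_mem := by
          intro y x hx
          have hx : G x = 0 := hx
          have := hlie y x
          rw [hx, lie_zero] at this
          exact (smul_eq_zero.mp this.symm).resolve_left hp0 }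
    have hvJ : b.equivFun.symm v ∈ J := by
      change G _ = 0
      apply b.equivFun.injective
      rw [hAG, LinearEquiv.apply_symm_apply, hv0, map_zero]
    have := hmem J (fun x hx => ⟨0, J.zero_mem, by rw [smul_zero]; exact hx⟩) _ hvJ
    exact hv (b.equivFun.symm.map_eq_zero_iff.mp this)
  have hsim := similitude_of_lie_multiplier h2.ne_zero hdet (d := d) (l := l) (c := p)
    fun u v => by
      have := congrArg b.equivFun (hlie (b.equivFun.symm u) (b.equivFun.symm v))
      rw [hb, map_smul, hAG, hAG, hAG, hb] at this
      simpa only [LinearEquiv.apply_symm_apply] using this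
  have hmin : ∀ i j k m, (p : ℤ_[p]) ∣ A i j * A k m - A i m * A k j := fun i j k m => by
    have hent : ∀ i j, A i j = b.equivFun (G (b j)) i := fun i j => LinearMap.toMatrix_apply ..
    simp only [hent]
    obtain ⟨z, hz⟩ | ⟨c, z, hz⟩ := hrank (b j) (b m)
    · rw [hz, map_smul]
      exact ⟨b.equivFun z i * b.equivFun (G (b m)) k - b.equivFun (G (b m)) i * b.equivFun z k, by
        simp only [Pi.smul_apply, smul_eq_mul]; ring⟩
    · rw [hz, map_add, map_smul, map_smul]
      exact ⟨b.equivFun (G (b j)) i * b.equivFun z k - b.equivFun z i * b.equivFun (G (b j)) k, by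
        simp only [Pi.add_apply, Pi.smul_apply, smul_eq_mul]; ring⟩
  obtain ⟨α, β, hideal, hcontr⟩ := exists_contracted_flag PadicInt.prime_p
    (hb.diagonal_mul_eq_zero h2) hd0 hd1 hd2 hmin hsim
  let J : LieIdeal ℤ_[p] N :=
    { carrier := {x | α ∣ b.equivFun x 1 ∧ β ∣ b.equivFun x 2}
      add_mem' := fun hx hy => by
        simp only [Set.mem_ofPred_eq, map_add, Pi.add_apply] at *
        exact ⟨dvd_add hx.1 hy.1, dvd_add hx.2 hy.2⟩
      zero_mem' := by simp
      smul_mem' := fun c x hx => by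
        simp only [Set.mem_ofPred_eq, map_smul, Pi.smul_apply, smul_eq_mul] at *
        exact ⟨hx.1.mul_left c, hx.2.mul_left c⟩
      lie_mem := fun {y x} hx => by
        have := hideal (b.equivFun x) (b.equivFun y) hx.1 hx.2
        change α ∣ b.equivFun ⁅y, x⁆ 1 ∧ β ∣ b.equivFun ⁅y, x⁆ 2
        rw [hb]
        simpa [mulVec_diagonal, cross_apply] using this }
  have hb0 : b 0 ∈ J := by
    change α ∣ b.equivFun (b 0) 1 ∧ β ∣ b.equivFun (b 0) 2
    simp
  refine b.ne_zero 0 (hmem J (fun x hx => ?_) _ hb0)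
  obtain ⟨⟨q, hq⟩, ⟨r, hr⟩, ⟨s, hs⟩⟩ := hcontr (b.equivFun x) hx.1 hx.2
  have hy : b.equivFun (b.equivFun.symm ![q, α * r, β * s]) = ![q, α * r, β * s] :=
    LinearEquiv.apply_symm_apply _ _
  refine ⟨b.equivFun.symm ![q, α * r, β * s], ?_, b.equivFun.injective ?_⟩
  · change α ∣ _ ∧ β ∣ _
    rw [hy]
    exact ⟨⟨r, rfl⟩, ⟨s, rfl⟩⟩
  · rw [map_smul, hy, hAG]
    ext i
    fin_cases i
    · simpa using hq
    · simpa [mul_assoc] using hr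
    · simpa [mul_assoc] using hs

end Obstruction

/-! ### Diagonalisation over the `p`-adic integers -/

section Diagonalization

variable {p : ℕ} [Fact p.Prime]

theorem PadicInt.dvd_of_norm_le {a b : ℤ_[p]} (h : ‖b‖ ≤ ‖a‖) : a ∣ b := by
  by_cases ha : a = 0
  · rw [ha, norm_zero, norm_le_zero_iff] at h
    rw [h]; exact dvd_zero _
  have ha' : (a : ℚ_[p]) ≠ 0 := PadicInt.coe_ne_zero.mpr ha
  refine ⟨⟨b / a, ?_⟩, Subtype.ext ?_⟩
  · rw [norm_div, ← PadicInt.norm_def, ← PadicInt.norm_def]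
    exact div_le_one_of_le₀ h (norm_nonneg _)
  · exact (mul_div_cancel₀ _ ha').symm

/-- Every vector over `ℚ_p` becomes integral after multiplication by a power of `p`. -/
theorem Padic.exists_pow_mul_eq_coe (v : Fin 3 → ℚ_[p]) :
    ∃ n : ℕ, ∀ k, n ≤ k → ∃ w : Fin 3 → ℤ_[p], ∀ i, (w i : ℚ_[p]) = (p : ℚ_[p]) ^ k * v i := by
  have hp1 : ‖(p : ℚ_[p])‖ < 1 := Padic.norm_p_lt_one
  obtain ⟨n, hn⟩ : ∃ n : ℕ, ∀ k, n ≤ k → ∀ i, ‖(p : ℚ_[p]) ^ k * v i‖ ≤ 1 := by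
    have : ∀ i, ∀ᶠ k : ℕ in Filter.atTop, ‖(p : ℚ_[p]) ^ k * v i‖ ≤ 1 := fun i => by
      have h0 : Filter.Tendsto (fun k : ℕ => (p : ℚ_[p]) ^ k * v i) Filter.atTop (nhds 0) := by
        simpa using (tendsto_pow_atTop_nhds_zero_of_norm_lt_one hp1).mul_const (v i)
      have := h0.norm
      rw [norm_zero] at this
      exact (this.eventually_lt_const one_pos).mono fun _ h => h.le
    exact Filter.eventually_atTop.mp (Filter.eventually_all.mpr this)
  exact ⟨n, fun k hk => ⟨fun i => ⟨_, hn k hk i⟩, fun i => rfl⟩⟩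

/-- A nonzero symmetric matrix over `ℤ_p` can be diagonalised by an integral change of basis,
invertible over `ℚ_p`, such that the diagonal entries decrease rapidly in absolute value. -/
theorem PadicInt.exists_diagonalization {S : Matrix (Fin 3) (Fin 3) ℤ_[p]} (hS : S.IsSymm)
    (hS0 : S ≠ 0) : ∃ (r : Matrix (Fin 3) (Fin 3) ℤ_[p]) (d : Fin 3 → ℤ_[p]),
      r.det ≠ 0 ∧ r * S * rᵀ = diagonal d ∧ d 0 ≠ 0 ∧ (p : ℤ_[p]) ^ 3 * d 0 ∣ d 1 ∧
        (p : ℤ_[p]) ^ 3 * d 1 ∣ d 2 := by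
  have : Invertible (2 : ℚ_[p]) := invertibleOfNonzero two_ne_zero
  let c : ℤ_[p] →+* ℚ_[p] := PadicInt.Coe.ringHom
  have hc : Function.Injective c := Subtype.coe_injective
  set T : Matrix (Fin 3) (Fin 3) ℚ_[p] := S.map c with hT
  have hTs : T.IsSymm := by rw [hT, IsSymm, ← transpose_map, hS.eq]
  have hT0 : T ≠ 0 := fun h => hS0 (Matrix.map_injective hc (by simpa [Matrix.map_zero] using h))
  let B : LinearMap.BilinForm ℚ_[p] (Fin 3 → ℚ_[p]) := Matrix.toBilin' T
  have hB : ∀ u v, B u v = u ⬝ᵥ (T *ᵥ v) := fun u v => Matrix.toBilin'_apply' _ _ _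
  have hBs : LinearMap.IsSymm B := ⟨fun u v => by
    rw [RingHom.id_apply]
    rw [hB, hB, dotProduct_mulVec, ← mulVec_transpose, hTs, dotProduct_comm]⟩
  obtain ⟨v', hv'⟩ := LinearMap.BilinForm.exists_orthogonal_basis (B := B) hBs
  let v := v'.reindex (finCongr (Module.finrank_fin_fun ℚ_[p]))
  have hv : ∀ i j, i ≠ j → B (v i) (v j) = 0 := fun i j hij => by
    simp only [v, Module.Basis.reindex_apply]
    exact hv' (fun h => hij ((finCongr _).symm.injective h))
  -- Sort the orthogonal basis so that the norms of the diagonal entries decrease.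
  let σ := Tuple.sort fun i => -‖B (v i) (v i)‖
  have hσ : ∀ i j, i ≤ j → ‖B (v (σ j)) (v (σ j))‖ ≤ ‖B (v (σ i)) (v (σ i))‖ := fun i j hij =>
    neg_le_neg_iff.mp (Tuple.monotone_sort (fun i => -‖B (v i) (v i)‖) hij)
  have hB0 : B (v (σ 0)) (v (σ 0)) ≠ 0 := fun h => by
    refine hT0 (Matrix.toBilin'.injective ?_)
    rw [map_zero]
    refine v.ext fun i => v.ext fun j => ?_
    by_cases hij : i = j
    · subst hij
      have := hσ 0 (σ.symm i) (Fin.zero_le _)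
      rw [h, norm_zero, norm_le_zero_iff, σ.apply_symm_apply] at this
      exact this
    · exact hv i j hij
  choose n hn using fun i => Padic.exists_pow_mul_eq_coe (v (σ i))
  -- Scaling by `p ^ (m + 2 i)` makes the vectors integral, and multiplies the ratio of consecutive
  -- diagonal entries by `p ^ 4`.
  let m := n 0 + n 1 + n 2
  have hm : ∀ i : Fin 3, n i ≤ m + 2 * i := fun i => by fin_cases i <;> simp [m] <;> omega
  choose w hw using fun i => hn i _ (hm i)
  let r : Matrix (Fin 3) (Fin 3) ℤ_[p] := .of w
  have hrow : ∀ i, (fun j => c (r i j)) = (p : ℚ_[p]) ^ (m + 2 * (i : ℕ)) • v (σ i) := fun i =>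
    funext fun j => hw i j
  have hent : ∀ i j, c ((r * S * rᵀ) i j) = (p : ℚ_[p]) ^ (m + 2 * (i : ℕ)) *
      ((p : ℚ_[p]) ^ (m + 2 * (j : ℕ)) * B (v (σ i)) (v (σ j))) := fun i j => by
    have hsmul : ∀ (a a' : ℚ_[p]) u u', a * (a' * B u u') = B (a • u) (a' • u') :=
      fun a a' u u' => by simp only [map_smul, LinearMap.smul_apply, smul_eq_mul]; ring
    rw [hsmul, ← hrow, ← hrow, hB]
    simp [Matrix.mul_apply, dotProduct, mulVec, hT, Fin.sum_univ_three]
    ring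
  have hp0 : (p : ℚ_[p]) ≠ 0 := Nat.cast_ne_zero.mpr (Fact.out : p.Prime).ne_zero
  have hdiag : r * S * rᵀ = diagonal fun i => (r * S * rᵀ) i i := by
    ext i j
    by_cases hij : i = j
    · subst hij; simp
    · rw [diagonal_apply_ne _ hij]
      apply hc
      rw [hent, hv _ _ (fun h => hij (σ.injective h))]
      simp
  have hgap : ∀ i j : Fin 3, (j : ℕ) = i + 1 →
      (p : ℤ_[p]) ^ 3 * (r * S * rᵀ) i i ∣ (r * S * rᵀ) j j := fun i j hij => by
    have hle : ‖(r * S * rᵀ) j j‖ ≤ ‖(p : ℤ_[p]) ^ 4 * (r * S * rᵀ) i i‖ := by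
      change ‖c ((r * S * rᵀ) j j)‖ ≤ ‖c ((p : ℤ_[p]) ^ 4 * (r * S * rᵀ) i i)‖
      rw [map_mul, hent, hent, map_pow, map_natCast, hij]
      have := hσ i j (by rw [Fin.le_def]; omega)
      simp only [norm_mul, norm_pow]
      calc _ ≤ ‖(p : ℚ_[p])‖ ^ (m + 2 * ((i : ℕ) + 1)) * (‖(p : ℚ_[p])‖ ^ (m + 2 * ((i : ℕ) + 1)) *
            ‖B (v (σ i)) (v (σ i))‖) := by gcongr
        _ = _ := by ring
    exact (Dvd.intro_left (p : ℤ_[p]) (by ring)).trans (PadicInt.dvd_of_norm_le hle)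
  refine ⟨r, _, ?_, hdiag, ?_, hgap 0 1 rfl, hgap 1 2 rfl⟩
  · intro h0
    obtain ⟨x, hx, hx0⟩ := exists_vecMul_eq_zero_iff.mpr h0
    have hli : LinearIndependent ℚ_[p] fun i : Fin 3 => (p : ℚ_[p]) ^ (m + 2 * (i : ℕ)) • v (σ i) :=
      (v.linearIndependent.comp σ σ.injective).units_smul fun i => Units.mk0 _ (pow_ne_zero _ hp0)
    refine hx (funext fun i => hc ?_)
    rw [Pi.zero_apply, map_zero]
    refine Fintype.linearIndependent_iff.mp hli (fun i => c (x i)) ?_ i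
    simp only [← hrow]
    ext j
    have := congrArg c (congrFun hx0 j)
    simpa [vecMul, dotProduct, Finset.sum_apply] using this
  · intro h0
    have := hent 0 0
    rw [h0, map_zero] at this
    have h1 := pow_ne_zero (m + 2 * ((0 : Fin 3) : ℕ)) hp0
    exact mul_ne_zero h1 (mul_ne_zero h1 hB0) this.symm

theorem PadicInt.finiteIndex_of_smul_mem {L : Type*} [AddCommGroup L] [Module ℤ_[p] L]
    [Module.Finite ℤ_[p] L] {c : ℤ_[p]} (hc : c ≠ 0) {N : Submodule ℤ_[p] L}
    (h : ∀ x, c • x ∈ N) : N.toAddSubgroup.FiniteIndex := by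
  have h1 : Finite (ℤ_[p] ⧸ Ideal.span {c}) := by
    have hle : Ideal.span {(p : ℤ_[p]) ^ c.valuation} ≤ Ideal.span {c} := by
      rw [Ideal.span_singleton_le_span_singleton]
      conv_lhs => rw [PadicInt.unitCoeff_spec hc]
      exact (Units.mul_left_dvd).mpr dvd_rfl
    rw [← PadicInt.ker_toZModPow] at hle
    have : NeZero (p ^ c.valuation) := ⟨pow_ne_zero _ (Fact.out : p.Prime).ne_zero⟩
    have : Finite (ℤ_[p] ⧸ RingHom.ker (PadicInt.toZModPow (p := p) c.valuation)) :=
      .of_injective _ (RingHom.kerLift_injective _)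
    exact .of_surjective _ (Ideal.Quotient.factor_surjective hle)
  have h2 : Finite (L ⧸ (⊤ : Submodule ℤ_[p] L)) := inferInstance
  have h3 := Submodule.finite_quotient_smul (Ideal.span {c}) (N := (⊤ : Submodule ℤ_[p] L))
    Module.Finite.fg_top
  have h4 : Ideal.span {c} • (⊤ : Submodule ℤ_[p] L) ≤ N := by
    rw [Submodule.ideal_span_singleton_smul]
    rintro _ ⟨x, -, rfl⟩
    exact h x
  have h5 : (Ideal.span {c} • (⊤ : Submodule ℤ_[p] L)).toAddSubgroup.FiniteIndex :=
    @AddSubgroup.finiteIndex_of_finite_quotient _ _ _ h3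
  exact AddSubgroup.finiteIndex_of_le
    (H := (Ideal.span {c} • (⊤ : Submodule ℤ_[p] L)).toAddSubgroup) h4

end Diagonalization

/-- A lattice that is hereditarily self-similar of index `p` has no symmetric part. -/
theorem eq_zero_of_isHereditarilySelfSimilarOfIndex {p : ℕ} [Fact p.Prime] (hp : 3 ≤ p)
    {L : Type*} [LieRing L] [LieAlgebra ℤ_[p] L] {b : Module.Basis (Fin 3) ℤ_[p] L}
    {S : Matrix (Fin 3) (Fin 3) ℤ_[p]} {l : Fin 3 → ℤ_[p]} (hS : S.IsSymm)
    (hb : HasStructure b S l) (h : IsHereditarilySelfSimilarOfIndex p 1 L) : S = 0 := by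
  by_contra hS0
  obtain ⟨r, d, hr, hrd, hd0, hd1, hd2⟩ := PadicInt.exists_diagonalization hS hS0
  have hdet : r.adjugate.det ≠ 0 := by
    rw [det_adjugate]
    exact pow_ne_zero _ hr
  obtain ⟨N, b', l', hb', hN⟩ :=
    hb.exists_subalgebra hdet (mul_adjugate_adjugate_transpose_eq hrd)
  have : Module.Finite ℤ_[p] L := .of_basis b
  exact not_isSelfSimilarOfIndex_of_hasStructure hp hb' hd0 hd1 hd2
    (h N (PadicInt.finiteIndex_of_smul_mem hdet hN))

/-! ### Scalar lattices -/

section Scalar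

variable {p : ℕ} [Fact p.Prime]

/-- A self-similarity datum written backwards: if an injective endomorphism `ψ` has image of index
`p` and no nonzero ideal `I` satisfies `I ⊆ ψ I`, then `ψ⁻¹` is a simple virtual endomorphism. -/
theorem isSelfSimilarOfIndex_of_lieHom {N : Type*} [LieRing N] [LieAlgebra ℤ_[p] N]
    (ψ : N →ₗ⁅ℤ_[p]⁆ N) (hψ : Function.Injective ψ) (g : N →+ ZMod p)
    (hg : Function.Surjective g) (hgψ : ∀ x, g x = 0 ↔ ∃ y, ψ y = x)
    (hI : ∀ I : LieIdeal ℤ_[p] N, (∀ x ∈ I, ∃ y ∈ I, ψ y = x) → I = ⊥) :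
    IsSelfSimilarOfIndex p 1 N := by
  let e := LieEquiv.ofInjective ψ hψ
  refine ⟨ψ.range, e.symm.toLieHom, ?_, fun I h => hI I fun x hx => ?_⟩
  · have : ψ.range.toSubmodule.toAddSubgroup = g.ker := by
      ext x
      exact (hgψ x).symm
    rw [this, AddSubgroup.index_ker, pow_one, AddMonoidHom.range_eq_top.mpr hg,
      AddSubgroup.card_top, Nat.card_zmod]
  · obtain ⟨hM, hφ⟩ := h x hx
    exact ⟨_, hφ, congrArg Subtype.val (e.apply_symm_apply ⟨x, hM⟩)⟩

theorem PadicInt.eq_zero_of_forall_pow_dvd {x : ℤ_[p]} (h : ∀ n : ℕ, (p : ℤ_[p]) ^ n ∣ x) :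
    x = 0 := by
  by_contra hx
  obtain ⟨n, hn⟩ := FiniteMultiplicity.of_prime_left PadicInt.prime_p hx
  exact hn (h _)

namespace ScalarLattice

/-- The element of a scalar lattice with the given coordinates. -/
def ofCoord (a : ℤ_[p]) (v : Fin 3 → ℤ_[p]) : ScalarLattice p a := v

theorem ofCoord_apply (a : ℤ_[p]) (v : Fin 3 → ℤ_[p]) (i : Fin 3) : ofCoord a v i = v i := rfl

/-- The map `(y₀, y₁, y₂) ↦ (y₁, y₂, p y₀)`, a cube root of multiplication by `p`. -/
noncomputable def rotate (p : ℕ) [Fact p.Prime] :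
    ScalarLattice p (0 : ℤ_[p]) →ₗ⁅ℤ_[p]⁆ ScalarLattice p (0 : ℤ_[p]) where
  toFun y := ofCoord 0 ![y 1, y 2, p * y 0]
  map_add' y z := funext fun i => by
    fin_cases i <;> simp [add_apply, ofCoord_apply, mul_add]
  map_smul' c y := funext fun i => by
    fin_cases i <;> simp [smul_apply, ofCoord_apply, mul_left_comm]
  map_lie' := funext fun i => by
    fin_cases i <;> simp [bracket_apply, ofCoord_apply]

/-- The map `(y₀, y₁, y₂) ↦ (y₀, y₂, p y₁)`, whose square is multiplication by `p` on the last two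
coordinates. -/
noncomputable def twist (p : ℕ) [Fact p.Prime] (a : ℤ_[p]) :
    ScalarLattice p a →ₗ⁅ℤ_[p]⁆ ScalarLattice p a where
  toFun y := ofCoord a ![y 0, y 2, p * y 1]
  map_add' y z := funext fun i => by
    fin_cases i <;> simp [add_apply, ofCoord_apply, mul_add]
  map_smul' c y := funext fun i => by
    fin_cases i <;> simp [smul_apply, ofCoord_apply, mul_left_comm]
  map_lie' := funext fun i => by
    fin_cases i <;> (simp [bracket_apply, ofCoord_apply]; try ring)

theorem rotate_apply (y : ScalarLattice p (0 : ℤ_[p])) (i : Fin 3) :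
    rotate p y i = ![y 1, y 2, p * y 0] i := rfl

theorem twist_apply (a : ℤ_[p]) (y : ScalarLattice p a) (i : Fin 3) :
    twist p a y i = ![y 0, y 2, p * y 1] i := rfl

/-- The last coordinate modulo `p`; its kernel is the image of `rotate` and of `twist`. -/
noncomputable def lastMod (p : ℕ) [Fact p.Prime] (a : ℤ_[p]) : ScalarLattice p a →+ ZMod p where
  toFun y := PadicInt.toZMod (y 2)
  map_zero' := map_zero _
  map_add' _ _ := map_add _ _ _

theorem lastMod_surjective (a : ℤ_[p]) : Function.Surjective (lastMod p a) := fun t => by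
  obtain ⟨c, hc⟩ := ZMod.ringHom_surjective (PadicInt.toZMod (p := p)) t
  exact ⟨ofCoord a ![0, 0, c], hc⟩

theorem lastMod_eq_zero_iff (a : ℤ_[p]) (y : ScalarLattice p a) :
    lastMod p a y = 0 ↔ (p : ℤ_[p]) ∣ y 2 := by
  rw [← Ideal.mem_span_singleton, ← PadicInt.maximalIdeal_eq_span_p, ← PadicInt.ker_toZMod]
  rfl

theorem isSelfSimilarOfIndex {N : Type*} [LieRing N] [LieAlgebra ℤ_[p] N] {a : ℤ_[p]}
    (e : N ≃ₗ⁅ℤ_[p]⁆ ScalarLattice p a) : IsSelfSimilarOfIndex p 1 N := by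
  have hp0 : (p : ℤ_[p]) ≠ 0 := Nat.cast_ne_zero.mpr (Fact.out : p.Prime).ne_zero
  -- It suffices to work with endomorphisms of the coordinate model.
  have key : ∀ ψ : ScalarLattice p a →ₗ⁅ℤ_[p]⁆ ScalarLattice p a, Function.Injective ψ →
      (∀ x : ScalarLattice p a, (p : ℤ_[p]) ∣ x 2 ↔ ∃ y, ψ y = x) →
      (∀ I : LieIdeal ℤ_[p] N, (∀ x ∈ I, ∃ y ∈ I, ψ (e y) = e x) → ∀ x ∈ I, e x = 0) →
      IsSelfSimilarOfIndex p 1 N := fun ψ hψ hrange hI => by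
    refine isSelfSimilarOfIndex_of_lieHom (e.symm.toLieHom.comp (ψ.comp e.toLieHom))
      (e.symm.injective.comp (hψ.comp e.injective)) ((lastMod p a).comp (e : N →+ _))
      ((lastMod_surjective a).comp e.surjective) (fun x => ?_) fun I h => ?_
    · refine (lastMod_eq_zero_iff a (e x)).trans ((hrange (e x)).trans ⟨?_, ?_⟩)
      · rintro ⟨y, hy⟩
        refine ⟨e.symm y, ?_⟩
        change e.symm (ψ (e (e.symm y))) = x
        rw [e.apply_symm_apply, hy, e.symm_apply_apply]
      · rintro ⟨y, hy⟩
        exact ⟨e y, by rw [← hy]; exact (e.apply_symm_apply _).symm⟩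
    · rw [eq_bot_iff]
      intro x hx
      have := hI I (fun x hx => by
        obtain ⟨y, hy, hyx⟩ := h x hx
        exact ⟨y, hy, by rw [← hyx]; exact (e.apply_symm_apply _).symm⟩) x hx
      rw [LieSubmodule.mem_bot]
      exact e.injective (this.trans (map_zero e).symm)
  by_cases ha : a = 0
  · subst ha
    refine key (rotate p) (fun y z h => ?_) (fun x => ⟨?_, ?_⟩) fun I hI x hx => ?_
    · have h0 := congrFun h 2
      have h1 := congrFun h 0
      have h2 := congrFun h 1
      simp only [rotate_apply, cons_val] at h0 h1 h2
      funext i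
      fin_cases i
      exacts [mul_left_cancel₀ hp0 h0, h1, h2]
    · rintro ⟨c, hc⟩
      refine ⟨ofCoord 0 ![c, x 0, x 1], funext fun i => ?_⟩
      fin_cases i <;> simp [rotate_apply, ofCoord_apply, hc]
    · rintro ⟨y, rfl⟩
      exact ⟨y 0, rfl⟩
    · -- Every element of `I` is `rotate ^ 3 = p` times an element of `I`.
      have hpow : ∀ n : ℕ, ∀ x ∈ I, ∀ i, (p : ℤ_[p]) ^ n ∣ e x i := fun n => by
        induction n with
        | zero => intro x _ i; rw [pow_zero]; exact one_dvd _
        | succ n ih =>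
          intro x hx i
          obtain ⟨y, hy, hyx⟩ := hI x hx
          obtain ⟨z, hz, hzy⟩ := hI y hy
          obtain ⟨w, hw, hwz⟩ := hI z hz
          have : e x i = p * e w i := by
            rw [← hyx, ← hzy, ← hwz]
            fin_cases i <;> rfl
          rw [this, pow_succ']
          exact mul_dvd_mul_left _ (ih w hw i)
      exact funext fun i => PadicInt.eq_zero_of_forall_pow_dvd fun n => hpow n x hx i
  · refine key (twist p a) (fun y z h => ?_) (fun x => ⟨?_, ?_⟩) fun I hI x hx => ?_
    · have h0 := congrFun h 0
      have h1 := congrFun h 2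
      have h2 := congrFun h 1
      simp only [twist_apply, cons_val] at h0 h1 h2
      funext i
      fin_cases i
      exacts [h0, mul_left_cancel₀ hp0 h1, h2]
    · rintro ⟨c, hc⟩
      refine ⟨ofCoord a ![x 0, c, x 1], funext fun i => ?_⟩
      fin_cases i <;> simp [twist_apply, ofCoord_apply, hc]
    · rintro ⟨y, rfl⟩
      exact ⟨y 1, rfl⟩
    · -- As `twist ^ 2` is `p` on the last two coordinates, these are infinitely divisible on `I`.
      have hpow : ∀ n : ℕ, ∀ x ∈ I,
          (p : ℤ_[p]) ^ n ∣ e x 1 ∧ (p : ℤ_[p]) ^ n ∣ e x 2 := fun n => by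
        induction n with
        | zero => intro x _; rw [pow_zero]; exact ⟨one_dvd _, one_dvd _⟩
        | succ n ih =>
          intro x hx
          obtain ⟨y, hy, hyx⟩ := hI x hx
          obtain ⟨z, hz, hzy⟩ := hI y hy
          have h1 : e x 1 = p * e z 1 := by rw [← hyx, ← hzy]; rfl
          have h2 : e x 2 = p * e z 2 := by rw [← hyx, ← hzy]; rfl
          rw [h1, h2, pow_succ']
          exact ⟨mul_dvd_mul_left _ (ih z hz).1, mul_dvd_mul_left _ (ih z hz).2⟩
      have hx1 : ∀ x ∈ I, e x 1 = 0 := fun x hx =>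
        PadicInt.eq_zero_of_forall_pow_dvd fun n => (hpow n x hx).1
      have hx2 := PadicInt.eq_zero_of_forall_pow_dvd fun n => (hpow n x hx).2
      -- The bracket with the second basis vector moves the first coordinate into the second.
      have hx0 : e x 0 = 0 := by
        have h := hx1 _ (I.lie_mem (x := e.symm (ofCoord a ![0, 1, 0])) hx)
        rw [LieEquiv.map_lie, e.apply_symm_apply, bracket_apply, ofCoord_apply,
          ofCoord_apply] at h
        have := (mul_eq_zero.mp h).resolve_left ha
        simp only [cons_val] at this
        linear_combination -this
      funext i
      fin_cases i
      exacts [hx0, hx1 x hx, hx2]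

end ScalarLattice

/-- A bracket of the form `[x, y] = l(x) y - l(y) x` is that of a scalar lattice: divide `l` by the
greatest common divisor `p ^ s` of its values and complete it to a system of coordinates. -/
theorem exists_lieEquiv_scalarLattice {L : Type*} [LieRing L] [LieAlgebra ℤ_[p] L]
    (b : Module.Basis (Fin 3) ℤ_[p] L) (l : L →ₗ[ℤ_[p]] ℤ_[p])
    (hl : ∀ x y : L, ⁅x, y⁆ = l x • y - l y • x) :
    ∃ a : ℤ_[p], (a = 0 ∨ ∃ s : ℕ, a = (p : ℤ_[p]) ^ s) ∧
      Nonempty (L ≃ₗ⁅ℤ_[p]⁆ ScalarLattice p a) := by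
  have key : ∀ (a : ℤ_[p]) (e : L ≃ₗ[ℤ_[p]] (Fin 3 → ℤ_[p])), (∀ x, l x = a * e x 0) →
      Nonempty (L ≃ₗ⁅ℤ_[p]⁆ ScalarLattice p a) := fun a e he => by
    let e' : L ≃ₗ[ℤ_[p]] ScalarLattice p a := e
    refine ⟨{ e' with map_lie' := fun {x y} => ?_ }⟩
    change e' ⁅x, y⁆ = ⁅e' x, e' y⁆
    funext i
    rw [ScalarLattice.bracket_apply, hl, map_sub, map_smul, map_smul]
    change l x * e y i - l y * e x i = a * (e x 0 * e y i - e x i * e y 0)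
    rw [he, he]
    ring
  obtain ⟨i, -, hi⟩ := Finset.exists_max_image Finset.univ (fun i => ‖l (b i)‖) ⟨0, by simp⟩
  have hsum : ∀ x, l x = ∑ j, b.equivFun x j * l (b j) := fun x => by
    conv_lhs => rw [← b.sum_equivFun x]
    simp only [map_sum, map_smul, smul_eq_mul]
  by_cases h0 : l (b i) = 0
  · refine ⟨0, .inl rfl, key 0 b.equivFun fun x => ?_⟩
    rw [zero_mul, hsum]
    refine Finset.sum_eq_zero fun j _ => ?_
    have := hi j (Finset.mem_univ j)
    rw [h0, norm_zero, norm_le_zero_iff] at this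
    rw [this, mul_zero]
  · have hu := PadicInt.unitCoeff_spec h0
    set a := (p : ℤ_[p]) ^ (l (b i)).valuation with ha
    have hdvd : ∀ j, a ∣ l (b j) := fun j =>
      (Dvd.intro_left _ hu.symm).trans (PadicInt.dvd_of_norm_le (hi j (Finset.mem_univ j)))
    choose q hq using hdvd
    have ha0 : a ≠ 0 := pow_ne_zero _ (Nat.cast_ne_zero.mpr (Fact.out : p.Prime).ne_zero)
    have hqi : IsUnit (q i) := by
      have : q i = PadicInt.unitCoeff h0 := mul_left_cancel₀ ha0 (by rw [← hq, mul_comm, ← hu])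
      rw [this]
      exact Units.isUnit _
    -- Since `q i` is a unit, `q` and the two coordinates other than the `i`-th are coordinates.
    let T : Matrix (Fin 3) (Fin 3) ℤ_[p] := .of ![q, Pi.single (i + 1) 1, Pi.single (i + 2) 1]
    have hT : T.det = q i := by
      rw [det_fin_three]
      fin_cases i <;> simp [T]
    have hTu : IsUnit T := by rw [isUnit_iff_isUnit_det, hT]; exact hqi
    refine ⟨a, .inr ⟨_, rfl⟩,
      key a (b.equivFun.trans (T.toLinearEquiv' hTu.invertible)) fun x => ?_⟩
    have : (b.equivFun.trans (T.toLinearEquiv' hTu.invertible)) x = T *ᵥ b.equivFun x := rfl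
    rw [this, hsum]
    simp only [mulVec, dotProduct, hq, Finset.mul_sum, T, of_apply, cons_val_zero]
    exact Finset.sum_congr rfl fun j _ => by ring

/-- Scalar lattices are hereditarily self-similar of index `p`, because every finite-index
subalgebra is again a scalar lattice. -/
theorem ScalarLattice.isHereditarilySelfSimilarOfIndex {L : Type*} [LieRing L]
    [LieAlgebra ℤ_[p] L] {a : ℤ_[p]} (e : L ≃ₗ⁅ℤ_[p]⁆ ScalarLattice p a) :
    IsHereditarilySelfSimilarOfIndex p 1 L := by
  intro N hN
  let e' : L ≃ₗ[ℤ_[p]] (Fin 3 → ℤ_[p]) := e.toLinearEquiv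
  let b : Module.Basis (Fin 3) ℤ_[p] L := .ofEquivFun e'
  have : Module.Free ℤ_[p] L := .of_basis b
  have : Module.Finite ℤ_[p] L := .of_basis b
  have hrank : Module.finrank ℤ_[p] N.toSubmodule = 3 := by
    have hL : Module.finrank ℤ_[p] L = 3 := by
      rw [Module.finrank_eq_card_basis b, Fintype.card_fin]
    refine le_antisymm ((Submodule.finrank_le _).trans hL.le) ?_
    have hn : (N.toSubmodule.toAddSubgroup.index : ℤ_[p]) ≠ 0 :=
      Nat.cast_ne_zero.mpr hN.index_ne_zero
    rw [← hL]
    refine LinearMap.finrank_le_finrank_of_injective (f := (LinearMap.lsmul ℤ_[p] L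
      N.toSubmodule.toAddSubgroup.index).codRestrict N.toSubmodule fun x => ?_) fun x y h => ?_
    · rw [LinearMap.lsmul_apply, Nat.cast_smul_eq_nsmul]
      exact AddSubgroup.nsmul_index_mem N.toSubmodule.toAddSubgroup x
    · exact smul_right_injective L hn (congrArg Subtype.val h)
  let l : L →ₗ[ℤ_[p]] ℤ_[p] := a • (LinearMap.proj 0 ∘ₗ e'.toLinearMap)
  have hl : ∀ x y : L, ⁅x, y⁆ = l x • y - l y • x := fun x y => by
    refine e.injective ((e.map_lie x y).trans ?_)
    have h : e (l x • y - l y • x) = l x • e y - l y • e x := by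
      change e.toLinearEquiv _ = l x • e.toLinearEquiv y - l y • e.toLinearEquiv x
      rw [map_sub, map_smul, map_smul]
    refine Eq.trans ?_ h.symm
    funext i
    rw [bracket_apply]
    change a * (e x 0 * e y i - e x i * e y 0) = a * e x 0 * e y i - a * e y 0 * e x i
    ring
  obtain ⟨a', -, ⟨f⟩⟩ := exists_lieEquiv_scalarLattice
    (Module.finBasisOfFinrankEq ℤ_[p] N.toSubmodule hrank) (L := N) (l ∘ₗ N.toSubmodule.subtype)
    fun x y => Subtype.ext (hl x y)
  exact isSelfSimilarOfIndex f

end Scalar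

/-! ### The classification -/

theorem mainTheorem7 (p : ℕ) [Fact p.Prime] (hp : 3 ≤ p) (L : Type*) [LieRing L]
    [LieAlgebra ℤ_[p] L] [Module.Free ℤ_[p] L] [Module.Finite ℤ_[p] L]
    (hL : Module.finrank ℤ_[p] L = 3) :
    IsHereditarilySelfSimilarOfIndex p 1 L ↔
      Nonempty (L ≃ₗ⁅ℤ_[p]⁆ LieLatticeL0 p) ∨
        ∃ s : ℕ, Nonempty (L ≃ₗ⁅ℤ_[p]⁆ LieLatticeL1 p s) := by
  constructor
  · intro h
    let b : Module.Basis (Fin 3) ℤ_[p] L := Module.finBasisOfFinrankEq ℤ_[p] L hL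
    obtain ⟨S, l, hS, hb⟩ := exists_hasStructure b (PadicInt.isUnit_two hp)
    obtain rfl := eq_zero_of_isHereditarilySelfSimilarOfIndex hp hS hb h
    obtain ⟨a, rfl | ⟨s, rfl⟩, ha⟩ := exists_lieEquiv_scalarLattice b
      ((dotProductBilin ℤ_[p] ℤ_[p] l) ∘ₗ b.equivFun.toLinearMap) fun x y =>
        b.equivFun.injective (by
          rw [hb, zero_mulVec, zero_add, map_sub, map_smul, map_smul]
          rfl)
    · exact .inl ha
    · exact .inr ⟨s, ha⟩
  · rintro (⟨⟨e⟩⟩ | ⟨s, ⟨e⟩⟩)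
    · exact ScalarLattice.isHereditarilySelfSimilarOfIndex e
    · exact ScalarLattice.isHereditarilySelfSimilarOfIndex e
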